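/- Theorem. Let $V$ be a complex vector space of finite dimension $n\ge 1$ and let $\mathfrak g=\mathfrak{sl}(V)$ be the space of traceless endomorphisms of $V$. For a vector space $W$, regard $\bigwedge^k\mathfrak g^*\otimes W$ as the space of alternating $k$-linear functions $\mathfrak g^k\to W$; the exterior product of such functions is the signed sum over shuffles, $$(\alpha\wedge\beta)(X_1,\dots,X_{k+l})=\frac1{k!\,l!}\sum_{\sigma\in S_{k+l}}\epsilon_\sigma\,\alpha(X_{\sigma(1)},\dots,X_{\sigma(k)})\otimes\beta(X_{\sigma(k+1)},\dots,X_{\sigma(k+l)}).$$ Let $$\Psi:S^n(V)\to\textstyle\bigwedge^{n-1}\mathfrak g^*\otimes\bigwedge^nV,\qquad \Phi^*:S^n(V^*)\to\textstyle\bigwedge^{n}\mathfrak g^*\otimes\bigwedge^nV^*$$ be the linear maps obtained by polarization from the homogeneous polynomial maps of degree $n$ $$\Psi(v^n)(A_1,\dots,A_{n-1})=A_1v\wedge A_2v\wedge\dots\wedge A_{n-1}v\wedge v,\qquad \Phi^*(\gamma^n)(A_1,\dots,A_n)=A_1^t\gamma\wedge A_2^t\gamma\wedge\dots\wedge A_n^t\gamma$$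 ($v\in V$, $\gamma\in V^*$, $A_i\in\mathfrak g$, $A^t\gamma=\gamma\circ A$). Let $I:\mathbb C\to S^n(V)\otimes S^n(V^*)$ be the canonical map dual to the perfect pairing $S^n(V)\times S^n(V^*)\to\mathbb C$ with $\langle v^n\,|\,\gamma^n\rangle=\langle v\,|\,\gamma\rangle^n$; that is, $I(1)=\sum_i s_i\otimes s_i^*$ for a basis $(s_i)$ of $S^n(V)$ and the basis $(s_i^*)$ of $S^n(V^*)$ dual to it under this pairing. Let $\bigwedge^nV\otimes\bigwedge^nV^*\to\mathbb C$ be the canonical trivialization $\langle v_1\wedge\dots\wedge v_n\,|\,\gamma_1\wedge\dots\wedge\gamma_n\rangle=\det(\langle v_i\,|\,\gamma_j\rangle)$. For linear maps $a:S^n(V)\to\bigwedge^i\mathfrak g^*\otimes\bigwedge^nV$ and $b:S^n(V^*)\to\bigwedge^j\mathfrak g^*\otimes\bigwedge^nV^*$, let $(a,b)\in\bigwedge^{i+j}\mathfrak g^*$ be the element obtained from $(a\otimes b)(I(1))$ by exterior multiplication of the alternating functions, followed by the canonical trivialization of their values. Finally, let $T_{n-1}\in\bigwedge^{2n-1}\mathfrak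 g^*$ be $$T_{n-1}(A_1,\dots,A_{2n-1})=\operatorname{tr}\big(St_{2n-1}(A_1,\dots,A_{2n-1})\big),\qquad St_k(x_1,\dots,x_k)=\sum_{\sigma\in S_k}\epsilon_\sigma\,x_{\sigma(1)}\cdots x_{\sigma(k)}.$$ Then $$(\Psi,\Phi^*)=\frac{(-1)^{\binom n2}}{n!}\,T_{n-1}\qquad\text{in }\textstyle\bigwedge^{2n-1}\mathfrak g^*.$$ -/

import Mathlib

open scoped TensorProduct

noncomputable section

namespace SlCovariants

section Sym

variable {V W : Type*} [AddCommGroup V] [Module ℂ V] [AddCommMonoid W] [Module ℂ W] {n : ℕ}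

/-- The universal property of the symmetric power: a symmetric multilinear map `f` on `V^n`
factors through `S^n(V)`. -/
def symLift (f : MultilinearMap ℂ (fun _ : Fin n => V) W)
    (hf : ∀ (e : Equiv.Perm (Fin n)) (v : Fin n → V), f (fun i => v (e i)) = f v) :
    Sym[ℂ]^n V →ₗ[ℂ] W :=
  { AddCon.lift (addConGen (SymmetricPower.Rel ℂ (Fin n) V))
      (PiTensorProduct.lift f).toAddMonoidHom
      (AddCon.addConGen_le.2 (by
        rintro _ _ ⟨e, v⟩
        simp [AddCon.ker_rel, hf e v])) with
    map_smul' := fun c x => by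
      induction x using AddCon.induction_on with
      | H x => exact (PiTensorProduct.lift f).map_smul c x }

theorem symLift_tprod (f : MultilinearMap ℂ (fun _ : Fin n => V) W)
    (hf : ∀ (e : Equiv.Perm (Fin n)) (v : Fin n → V), f (fun i => v (e i)) = f v)
    (v : Fin n → V) : symLift f hf (SymmetricPower.tprod ℂ v) = f v :=
  PiTensorProduct.lift.tprod v

variable (V n) in
/-- Polarization `S^n(V) → V^{⊗n}`,
`v₁ ⋯ vₙ ↦ (1/n!) ∑_σ v_{σ(1)} ⊗ ⋯ ⊗ v_{σ(n)}`; in particular `v^n ↦ v^{⊗n}`. -/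
def polarization : Sym[ℂ]^n V →ₗ[ℂ] ⨂[ℂ]^n V :=
  symLift ((n.factorial : ℂ)⁻¹ • ∑ σ : Equiv.Perm (Fin n),
      (PiTensorProduct.tprod ℂ (s := fun _ : Fin n => V)).domDomCongr σ) (by
    intro e v
    simp only [smul_apply, sum_apply, MultilinearMap.domDomCongr_apply]
    congr 1
    exact Fintype.sum_equiv (Equiv.mulLeft e) _ _ (fun σ => rfl))

theorem polarization_tprod (v : Fin n → V) :
    polarization V n (SymmetricPower.tprod ℂ v) =
      (n.factorial : ℂ)⁻¹ • ∑ σ : Equiv.Perm (Fin n),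
        PiTensorProduct.tprod ℂ (fun i => v (σ i)) := by
  simp [polarization, symLift_tprod]

variable (V n) in
/-- The natural pairing `S^n(V) × S^n(V*) → ℂ`, i.e. the pairing of `V^{⊗n}` with `(V*)^{⊗n}`
transported by polarization; it is normalized by `⟨v^n | γ^n⟩ = ⟨v | γ⟩^n`. -/
def symPairing : Sym[ℂ]^n V →ₗ[ℂ] Sym[ℂ]^n (Module.Dual ℂ V) →ₗ[ℂ] ℂ :=
  (TensorPower.pairingDual ℂ V n ∘ₗ polarization (Module.Dual ℂ V) n).flip ∘ₗ polarization V n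

theorem symPairing_pow (v : V) (γ : Module.Dual ℂ V) :
    symPairing V n (SymmetricPower.tprod ℂ fun _ => v) (SymmetricPower.tprod ℂ fun _ => γ) =
      γ v ^ n := by
  have h : (n.factorial : ℂ) ≠ 0 := by exact_mod_cast n.factorial_ne_zero
  simp [symPairing, polarization_tprod, Fintype.card_perm, h]

theorem symPairing_tprod (v : Fin n → V) (γ : Fin n → Module.Dual ℂ V) :
    symPairing V n (SymmetricPower.tprod ℂ v) (SymmetricPower.tprod ℂ γ) =
      (n.factorial : ℂ)⁻¹ * ∑ σ : Equiv.Perm (Fin n), ∏ i, γ (σ i) (v i) := by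
  have h : (n.factorial : ℂ) ≠ 0 := by exact_mod_cast n.factorial_ne_zero
  simp only [symPairing, LinearMap.coe_comp, Function.comp_apply, LinearMap.flip_apply,
    polarization_tprod, map_smul, map_sum, LinearMap.smul_apply, LinearMap.sum_apply,
    TensorPower.pairingDual_tprod_tprod, smul_eq_mul]
  have key : ∀ τ : Equiv.Perm (Fin n),
      ∑ σ : Equiv.Perm (Fin n), ∏ i, γ (σ i) (v (τ i)) =
        ∑ σ : Equiv.Perm (Fin n), ∏ i, γ (σ i) (v i) := by
    intro τ
    refine Fintype.sum_equiv (Equiv.mulRight τ⁻¹) _ _ (fun σ => ?_)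
    exact Fintype.prod_equiv τ _ _ (fun i => by simp)
  simp only [key, Finset.sum_const, Finset.card_univ, Fintype.card_perm, Fintype.card_fin,
    nsmul_eq_mul]
  field_simp

instance [FiniteDimensional ℂ V] : FiniteDimensional ℂ (Sym[ℂ]^n V) :=
  Module.Finite.of_surjective (SymmetricPower.mk ℂ (Fin n) V)
    (LinearMap.range_eq_top.1 (SymmetricPower.range_mk ℂ (Fin n) V))

/-- The natural pairing between `S^n(V)` and `S^n(V*)` is perfect. -/
instance symPairing_isPerfPair [FiniteDimensional ℂ V] : (symPairing V n).IsPerfPair := by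
  classical
  have hn : (n.factorial : ℂ) ≠ 0 := by exact_mod_cast n.factorial_ne_zero
  let b := Module.finBasis ℂ V
  have h₁ : ∀ s : Sym[ℂ]^n V, s = ∑ f : Fin n → Fin (Module.finrank ℂ V),
      symPairing V n s (SymmetricPower.tprod ℂ fun i => b.coord (f i)) •
        SymmetricPower.tprod ℂ (fun i => b (f i)) := by
    intro s
    have hs : s ∈ Submodule.span ℂ (Set.range (SymmetricPower.tprod ℂ (ι := Fin n) (M := V))) := by
      rw [SymmetricPower.span_tprod_eq_top]; trivial
    induction hs using Submodule.span_induction with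
    | mem x hx =>
      obtain ⟨v, rfl⟩ := hx
      have h (σ : Equiv.Perm (Fin n)) : SymmetricPower.tprod ℂ v =
          ∑ f : Fin n → Fin (Module.finrank ℂ V),
            (∏ i, b.coord (f (σ i)) (v i)) • SymmetricPower.tprod ℂ (fun i => b (f i)) := by
        conv_lhs => rw [← SymmetricPower.tprod_equiv σ⁻¹ v]
        have : (fun i => v (σ⁻¹ i)) =
            fun i => ∑ j, b.coord j (v (σ⁻¹ i)) • b j := by
          funext i; exact (b.sum_repr _).symm
        rw [this, MultilinearMap.map_sum]
        refine Finset.sum_congr rfl fun f _ => ?_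
        rw [MultilinearMap.map_smul_univ]
        congr 1
        exact (Fintype.prod_equiv σ _ _ (fun i => by simp)).symm
      simp only [symPairing_tprod, mul_smul, Finset.sum_smul]
      rw [← Finset.smul_sum, Finset.sum_comm]
      simp only [← h, Finset.sum_const, Finset.card_univ, Fintype.card_perm, Fintype.card_fin]
      rw [← Nat.cast_smul_eq_nsmul ℂ, inv_smul_smul₀ hn]
    | zero => simp
    | add x y _ _ hx hy =>
      simp only [map_add, LinearMap.add_apply, add_smul, Finset.sum_add_distrib]
      rw [← hx, ← hy]
    | smul c x _ hx =>
      simp only [map_smul, LinearMap.smul_apply, smul_assoc]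
      rw [← Finset.smul_sum, ← hx]
  have h₂ : ∀ t : Sym[ℂ]^n (Module.Dual ℂ V), t = ∑ f : Fin n → Fin (Module.finrank ℂ V),
      symPairing V n (SymmetricPower.tprod ℂ fun i => b (f i)) t •
        SymmetricPower.tprod ℂ (fun i => b.coord (f i)) := by
    intro t
    have ht : t ∈ Submodule.span ℂ
        (Set.range (SymmetricPower.tprod ℂ (ι := Fin n) (M := Module.Dual ℂ V))) := by
      rw [SymmetricPower.span_tprod_eq_top]; trivial
    induction ht using Submodule.span_induction with
    | mem x hx =>
      obtain ⟨γ, rfl⟩ := hx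
      have h (σ : Equiv.Perm (Fin n)) : SymmetricPower.tprod ℂ γ =
          ∑ f : Fin n → Fin (Module.finrank ℂ V),
            (∏ i, γ (σ i) (b (f i))) • SymmetricPower.tprod ℂ (fun i => b.coord (f i)) := by
        conv_lhs => rw [← SymmetricPower.tprod_equiv σ γ]
        have : (fun i => γ (σ i)) = fun i => ∑ j, γ (σ i) (b j) • b.coord j := by
          funext i
          refine b.ext fun k => ?_
          simp
        rw [this, MultilinearMap.map_sum]
        refine Finset.sum_congr rfl fun f _ => ?_
        rw [MultilinearMap.map_smul_univ]
      simp only [symPairing_tprod, mul_smul, Finset.sum_smul]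
      rw [← Finset.smul_sum, Finset.sum_comm]
      simp only [← h, Finset.sum_const, Finset.card_univ, Fintype.card_perm, Fintype.card_fin]
      rw [← Nat.cast_smul_eq_nsmul ℂ, inv_smul_smul₀ hn]
    | zero => simp
    | add x y _ _ hx hy =>
      simp only [map_add, add_smul, Finset.sum_add_distrib]
      rw [← hx, ← hy]
    | smul c x _ hx =>
      simp only [map_smul, smul_assoc]
      rw [← Finset.smul_sum, ← hx]
  refine LinearMap.IsPerfPair.of_injective ?_ ?_
  · refine (injective_iff_map_eq_zero _).2 fun s hs => ?_
    rw [h₁ s]; simp [hs]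
  · refine (injective_iff_map_eq_zero _).2 fun t ht => ?_
    rw [h₂ t]
    refine Finset.sum_eq_zero fun f _ => ?_
    have := LinearMap.congr_fun ht (SymmetricPower.tprod ℂ fun i => b (f i))
    rw [LinearMap.flip_apply] at this
    rw [this]; simp

variable (V n) in
/-- The canonical map `I : ℂ → S^n(V) ⊗ S^n(V*)`: the coevaluation
`ℂ → S^n(V) ⊗ S^n(V)^*` followed by the identification `S^n(V)^* ≃ S^n(V*)` that is given by the
natural pairing. -/
def canonicalMap [FiniteDimensional ℂ V] :
    ℂ →ₗ[ℂ] (Sym[ℂ]^n V) ⊗[ℂ] (Sym[ℂ]^n (Module.Dual ℂ V)) :=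
  LinearMap.lTensor (Sym[ℂ]^n V) (symPairing V n).flip.toPerfPair.symm.toLinearMap ∘ₗ
    coevaluation ℂ (Sym[ℂ]^n V)

end Sym

section Wedge

variable (V : Type*) [AddCommGroup V] [Module ℂ V]

/-- The vector space `sl(V)` of traceless endomorphisms of `V`. -/
abbrev sl : Submodule ℂ (Module.End ℂ V) :=
  LinearMap.ker (LinearMap.trace ℂ V)

variable {V} in
/-- The alternating function `(A₁, …, Aₙ) ↦ (1/n!) ∑_σ A₁ v_{σ(1)} ∧ ⋯ ∧ Aₙ v_{σ(n)}` on `End(V)`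
with values in `⋀ⁿ V`, for given `v₁, …, vₙ` in `V`. -/
def polarizedWedgeAt {n : ℕ} (v : Fin n → V) : Module.End ℂ V [⋀^Fin n]→ₗ[ℂ] ⋀[ℂ]^n V where
  toFun := fun A => (n.factorial : ℂ)⁻¹ • ∑ σ : Equiv.Perm (Fin n),
    exteriorPower.ιMulti ℂ n (fun i => A i (v (σ i)))
  map_update_add' := by
    intro _ A i x y
    have h (z : Module.End ℂ V) (σ : Equiv.Perm (Fin n)) :
        (fun k => Function.update A i z k (v (σ k))) =
          Function.update (fun k => A k (v (σ k))) i (z (v (σ i))) :=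
      funext fun k => Function.apply_update (fun k (B : Module.End ℂ V) => B (v (σ k))) A i z k
    simp only [h, LinearMap.add_apply, AlternatingMap.map_update_add,
      Finset.sum_add_distrib, smul_add]
  map_update_smul' := by
    intro _ A i c x
    have h (z : Module.End ℂ V) (σ : Equiv.Perm (Fin n)) :
        (fun k => Function.update A i z k (v (σ k))) =
          Function.update (fun k => A k (v (σ k))) i (z (v (σ i))) :=
      funext fun k => Function.apply_update (fun k (B : Module.End ℂ V) => B (v (σ k))) A i z k
    simp only [h, LinearMap.smul_apply, AlternatingMap.map_update_smul,
      ← Finset.smul_sum]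
    exact smul_comm _ _ _
  map_eq_zero_of_eq' := by
    intro A i j hA hij
    refine smul_eq_zero_of_right _ (Finset.sum_involution
      (fun σ _ => σ * Equiv.swap i j) (fun σ _ => ?_) (fun σ _ _ => ?_)
      (fun σ _ => Finset.mem_univ _) (fun σ _ => by simp [mul_assoc]))
    · have h : (fun k => A k (v ((σ * Equiv.swap i j) k))) =
          (fun k => A k (v (σ k))) ∘ Equiv.swap i j := by
        funext k
        have hk : A k = A (Equiv.swap i j k) := by
          rcases eq_or_ne k i with rfl | hi
          · simpa using hA
          rcases eq_or_ne k j with rfl | hj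
          · simpa using hA.symm
          rw [Equiv.swap_apply_of_ne_of_ne hi hj]
        simp [hk]
      rw [h, AlternatingMap.map_swap _ _ hij, add_neg_cancel]
    · exact fun h => hij (by simpa using h)

variable {V} in
theorem polarizedWedgeAt_apply {n : ℕ} (v : Fin n → V) (A : Fin n → Module.End ℂ V) :
    polarizedWedgeAt v A = (n.factorial : ℂ)⁻¹ • ∑ σ : Equiv.Perm (Fin n),
      exteriorPower.ιMulti ℂ n (fun i => A i (v (σ i))) := rfl

/-- `polarizedWedgeAt v` as a multilinear function of `v`. -/
def polarizedWedge (n : ℕ) :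
    MultilinearMap ℂ (fun _ : Fin n => V) (Module.End ℂ V [⋀^Fin n]→ₗ[ℂ] ⋀[ℂ]^n V) where
  toFun v := polarizedWedgeAt v
  map_update_add' := by
    intro _ v i x y
    refine AlternatingMap.ext fun A => ?_
    have h (z : V) (σ : Equiv.Perm (Fin n)) :
        (fun k => A k (Function.update v i z (σ k))) =
          Function.update (fun k => A k (v (σ k))) (σ.symm i) (A (σ.symm i) z) := by
      funext k
      rcases eq_or_ne k (σ.symm i) with rfl | hk
      · simp
      · have : σ k ≠ i := fun e => hk (by simp [← e])
        simp [hk, this]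
    simp only [polarizedWedgeAt_apply, AlternatingMap.add_apply, h, map_add,
      AlternatingMap.map_update_add, Finset.sum_add_distrib, smul_add]
  map_update_smul' := by
    intro _ v i c x
    refine AlternatingMap.ext fun A => ?_
    have h (z : V) (σ : Equiv.Perm (Fin n)) :
        (fun k => A k (Function.update v i z (σ k))) =
          Function.update (fun k => A k (v (σ k))) (σ.symm i) (A (σ.symm i) z) := by
      funext k
      rcases eq_or_ne k (σ.symm i) with rfl | hk
      · simp
      · have : σ k ≠ i := fun e => hk (by simp [← e])
        simp [hk, this]
    simp only [polarizedWedgeAt_apply, AlternatingMap.smul_apply, h, map_smul,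
      AlternatingMap.map_update_smul, ← Finset.smul_sum]
    exact smul_comm _ _ _

theorem polarizedWedge_apply (n : ℕ) (v : Fin n → V) (A : Fin n → Module.End ℂ V) :
    polarizedWedge V n v A = (n.factorial : ℂ)⁻¹ • ∑ σ : Equiv.Perm (Fin n),
      exteriorPower.ιMulti ℂ n (fun i => A i (v (σ i))) := rfl

theorem polarizedWedge_perm (n : ℕ) (e : Equiv.Perm (Fin n)) (v : Fin n → V) :
    polarizedWedge V n (fun i => v (e i)) = polarizedWedge V n v := by
  refine AlternatingMap.ext fun A => ?_
  rw [polarizedWedge_apply, polarizedWedge_apply]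
  congr 1
  exact Fintype.sum_equiv (Equiv.mulLeft e) _ _ (fun σ => rfl)

/-- The linear map on `S^n(V)` that is induced by `polarizedWedge`. It sends `v^n` to
`(A₁, …, Aₙ) ↦ A₁ v ∧ ⋯ ∧ Aₙ v`. -/
def wedgeEnd (n : ℕ) : Sym[ℂ]^n V →ₗ[ℂ] (Module.End ℂ V [⋀^Fin n]→ₗ[ℂ] ⋀[ℂ]^n V) :=
  symLift (polarizedWedge V n) (polarizedWedge_perm V n)

theorem wedgeEnd_pow (n : ℕ) (v : V) (A : Fin n → Module.End ℂ V) :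
    wedgeEnd V n (SymmetricPower.tprod ℂ fun _ => v) A =
      exteriorPower.ιMulti ℂ n (fun i => A i v) := by
  have h : (n.factorial : ℂ) ≠ 0 := by exact_mod_cast n.factorial_ne_zero
  rw [wedgeEnd, symLift_tprod, polarizedWedge_apply, Finset.sum_const, Finset.card_univ, Fintype.card_perm, Fintype.card_fin,
    ← Nat.cast_smul_eq_nsmul ℂ, inv_smul_smul₀ h]

/-- The linear map `Ψ : S^n(V) → ⋀^{n-1} sl(V)* ⊗ ⋀^n V`, for `n = m + 1`. The target is the space
of alternating multilinear functions of `n - 1` variables in `sl(V)` with values in `⋀^n V`, and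
`Ψ(v^n)(A₁, …, A_{n-1}) = A₁ v ∧ ⋯ ∧ A_{n-1} v ∧ v`. -/
def Psi (m : ℕ) : Sym[ℂ]^(m + 1) V →ₗ[ℂ] (sl V [⋀^Fin m]→ₗ[ℂ] ⋀[ℂ]^(m + 1) V) where
  toFun s :=
    have h [DecidableEq (Fin m)] (A : Fin m → sl V) (i : Fin m) (x : sl V) :
        (fun k => (Function.update A i x k : Module.End ℂ V)) =
          Function.update (fun k => (A k : Module.End ℂ V)) i (x : Module.End ℂ V) :=
      funext fun k => Function.apply_update (fun _ (B : sl V) => (B : Module.End ℂ V)) A i x k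
    { toFun := fun A => wedgeEnd V (m + 1) s
        (Fin.snoc (α := fun _ => Module.End ℂ V) (fun i => (A i : Module.End ℂ V)) 1)
      map_update_add' := by
        intro inst A i x y
        obtain rfl := Subsingleton.elim inst (instDecidableEqFin m)
        simp only [h, Fin.snoc_update, Submodule.coe_add, AlternatingMap.map_update_add]
      map_update_smul' := by
        intro inst A i c x
        obtain rfl := Subsingleton.elim inst (instDecidableEqFin m)
        simp only [h, Fin.snoc_update, Submodule.coe_smul, AlternatingMap.map_update_smul]
      map_eq_zero_of_eq' := by
        intro A i j hA hij
        exact (wedgeEnd V (m + 1) s).map_eq_zero_of_eq _ (i := i.castSucc) (j := j.castSucc)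
          (by simp [hA]) (by simpa using hij) }
  map_add' _ _ := by ext; simp
  map_smul' _ _ := by ext; simp

theorem Psi_apply (m : ℕ) (s : Sym[ℂ]^(m + 1) V) (A : Fin m → sl V) :
    Psi V m s A = wedgeEnd V (m + 1) s
      (Fin.snoc (α := fun _ => Module.End ℂ V) (fun i => (A i : Module.End ℂ V)) 1) := rfl

theorem Psi_pow (m : ℕ) (v : V) (A : Fin m → sl V) :
    Psi V m (SymmetricPower.tprod ℂ fun _ => v) A =
      exteriorPower.ιMulti ℂ (m + 1)
        (Fin.snoc (α := fun _ => V) (fun i => (A i : Module.End ℂ V) v) v) := by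
  rw [Psi_apply, wedgeEnd_pow]
  congr 1
  ext i
  cases i using Fin.lastCases <;> simp

/-- The linear map `Φ* : S^n(V*) → ⋀^n sl(V)* ⊗ ⋀^n V*`. The target is the space of alternating
multilinear functions of `n` variables in `sl(V)` with values in `⋀^n V*`, and
`Φ*(γ^n)(A₁, …, Aₙ) = A₁ᵗ γ ∧ ⋯ ∧ Aₙᵗ γ`. -/
def PhiStar (n : ℕ) :
    Sym[ℂ]^n (Module.Dual ℂ V) →ₗ[ℂ] (sl V [⋀^Fin n]→ₗ[ℂ] ⋀[ℂ]^n (Module.Dual ℂ V)) where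
  toFun s := (wedgeEnd (Module.Dual ℂ V) n s).compLinearMap
    (Module.Dual.transpose ∘ₗ (sl V).subtype)
  map_add' _ _ := by ext; simp
  map_smul' _ _ := by ext; simp

theorem PhiStar_apply (n : ℕ) (s : Sym[ℂ]^n (Module.Dual ℂ V)) (A : Fin n → sl V) :
    PhiStar V n s A = wedgeEnd (Module.Dual ℂ V) n s
      (fun i => Module.Dual.transpose (A i : Module.End ℂ V)) := rfl

theorem PhiStar_pow (n : ℕ) (γ : Module.Dual ℂ V) (A : Fin n → sl V) :
    PhiStar V n (SymmetricPower.tprod ℂ fun _ => γ) A =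
      exteriorPower.ιMulti ℂ n (fun i => γ ∘ₗ (A i : Module.End ℂ V)) := by
  rw [PhiStar_apply, wedgeEnd_pow]
  rfl

/-- The canonical map `⋀^n V ⊗ ⋀^n V* → ℂ`,
`⟨v₁ ∧ ⋯ ∧ vₙ | γ₁ ∧ ⋯ ∧ γₙ⟩ = det (⟨v_i | γ_j⟩)`. -/
def trivialization (n : ℕ) : (⋀[ℂ]^n V) ⊗[ℂ] (⋀[ℂ]^n (Module.Dual ℂ V)) →ₗ[ℂ] ℂ :=
  TensorProduct.lift (exteriorPower.pairingDual ℂ V n).flip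

theorem trivialization_ιMulti (n : ℕ) (v : Fin n → V) (γ : Fin n → Module.Dual ℂ V) :
    trivialization V n (exteriorPower.ιMulti ℂ n v ⊗ₜ exteriorPower.ιMulti ℂ n γ) =
      Matrix.det (Matrix.of fun i j => γ j (v i)) := by
  simp [trivialization]

variable {V} in
/-- The pairing `(a, b) ∈ ⋀^{i+j} sl(V)*` of `a : S^n(V) → ⋀^i sl(V)* ⊗ ⋀^n V` and
`b : S^n(V*) → ⋀^j sl(V)* ⊗ ⋀^n V*`: apply `a ⊗ b` to the canonical element `I(1)`, multiply the
alternating functions exteriorly (`AlternatingMap.domCoprod'`, the signed sum over shuffles), and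
contract the values by the canonical trivialization. -/
def covariantPairing [FiniteDimensional ℂ V] {n i j : ℕ}
    (a : Sym[ℂ]^n V →ₗ[ℂ] (sl V [⋀^Fin i]→ₗ[ℂ] ⋀[ℂ]^n V))
    (b : Sym[ℂ]^n (Module.Dual ℂ V) →ₗ[ℂ] (sl V [⋀^Fin j]→ₗ[ℂ] ⋀[ℂ]^n (Module.Dual ℂ V))) :
    sl V [⋀^Fin (i + j)]→ₗ[ℂ] ℂ :=
  ((trivialization V n).compAlternatingMap
    (AlternatingMap.domCoprod' (TensorProduct.map a b (canonicalMap V n 1)))).domDomCongr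
      finSumFinEquiv

/-- The standard polynomial `St_k(x₁, …, x_k) = ∑_σ ε_σ x_{σ(1)} ⋯ x_{σ(k)}` on an algebra. -/
def standardPolynomial (R : Type*) [Ring R] [Algebra ℂ R] (k : ℕ) : R [⋀^Fin k]→ₗ[ℂ] R :=
  MultilinearMap.alternatization (MultilinearMap.mkPiAlgebraFin ℂ k R)

theorem standardPolynomial_apply (R : Type*) [Ring R] [Algebra ℂ R] (k : ℕ) (x : Fin k → R) :
    standardPolynomial R k x = ∑ σ : Equiv.Perm (Fin k),
      Equiv.Perm.sign σ • (List.ofFn fun i => x (σ i)).prod := by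
  simp [standardPolynomial, MultilinearMap.alternatization_apply]

/-- The invariant `T_k = tr(St_{2k+1}(A₁, …, A_{2k+1}))` in `⋀^{2k+1} sl(V)*`. -/
def primitiveInvariant (k : ℕ) : sl V [⋀^Fin (2 * k + 1)]→ₗ[ℂ] ℂ :=
  ((LinearMap.trace ℂ V).compAlternatingMap
    (standardPolynomial (Module.End ℂ V) (2 * k + 1))).compLinearMap (sl V).subtype

end Wedge

end SlCovariants

end

/-! Write n = m + 1. The element I(1) is the sum of e_f ⊗ e_f^* over all words f of length n in a
basis. Contracting it between wedges built from A_1, …, A_n and B_1, …, B_n gives determinants;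
their Leibniz expansion is 1/n! times a signed sum over ρ of `permTrace` of the matrices B_{ρ(i)}
A_i. For Ψ the last A is the identity. The antisymmetrization in the exterior product absorbs ρ at
the cost of a factor n!.

The remaining signed sum is encoded in Grassmann variables. Let X = ∑ e_k A_k, a matrix with odd
entries. The m products B_i A_i become copies of X², whose entries commute, and the unpaired B_n
becomes X. Reordering a_1 ⋯ a_m b_1 ⋯ b_n as (b_1 a_1) ⋯ (b_m a_m) b_n produces (-1)^{n choose 2}
(`sum_sign_sum_perm_prod`).

Since X is odd, tr X^{2k} = 0 for k > 0 (`trace_evenMatrix_pow`). Hence only the n-cycles contribute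
to `permTrace`. There are m! of them, each giving tr X^{2n-1}, whose top coefficient is T_{n-1}
(`berezin_trace_pow`). Dividing by the wedge normalization m! n! leaves 1/n!. -/

open scoped TensorProduct

noncomputable section

namespace SlCovariants

/-! ### Sums over permutations of products of traces along cycles. -/

section PermTrace

variable {ι R : Type*} [Fintype ι] [CommRing R]

/-- `∑_τ ∏_{cycles of τ} tr (product of the C_i along the cycle)`: this is `n!` times the trace of
the symmetric product `C₁ ⋯ Cₙ` on the `n`-th symmetric power. -/
def permTrace {n : ℕ} (C : Fin n → Matrix ι ι R) : R :=
  ∑ τ : Equiv.Perm (Fin n), ∑ g : Fin n → ι, ∏ i, C i (g (τ i)) (g i)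

theorem permTrace_one (C : Fin 1 → Matrix ι ι R) : permTrace C = (C 0).trace := by
  rw [permTrace, Fintype.sum_unique, ← (Equiv.funUnique (Fin 1) ι).symm.sum_comp]
  simp [Matrix.trace]

/-- Either 0 is a fixed point and splits off its own trace, or 0 is deleted from its cycle by
merging its matrix with that of its preimage j. -/
theorem permTrace_succ {n : ℕ} (C : Fin (n + 1) → Matrix ι ι R) :
    permTrace C = (C 0).trace * permTrace (fun i => C i.succ) +
      ∑ j, permTrace (Function.update (fun i => C i.succ) j (C 0 * C j.succ)) := by
  rw [permTrace, ← Equiv.Perm.decomposeFin.symm.sum_comp, Fintype.sum_prod_type,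
    Fin.sum_univ_succ]
  simp only [← (Fin.consEquiv fun _ : Fin (n + 1) => ι).sum_comp, Fintype.sum_prod_type,
    Fin.prod_univ_succ, Equiv.Perm.decomposeFin_symm_apply_zero,
    Equiv.Perm.decomposeFin_symm_apply_succ, Fin.consEquiv_apply, Fin.cons_zero, Fin.cons_succ,
    Equiv.swap_self, Equiv.refl_apply]
  congr 1
  · simp only [permTrace, Matrix.trace, Matrix.diag, Finset.sum_mul, Finset.mul_sum]
    refine Finset.sum_congr rfl fun τ _ => ?_
    rw [Finset.sum_comm]
  · rw [Finset.sum_comm]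
    simp only [permTrace]
    conv_rhs => rw [Finset.sum_comm]
    refine Finset.sum_congr rfl fun e _ => ?_
    -- The image of 0 is written as e j, so that j indexes the preimage of 0; summing over the value
    -- of g at 0 then forms the product of the two matrices.
    rw [← Equiv.sum_comp e]
    refine Finset.sum_congr rfl fun j _ => ?_
    rw [Finset.sum_comm]
    refine Finset.sum_congr rfl fun g _ => ?_
    simp only [← Finset.mul_prod_erase _ _ (Finset.mem_univ j), Equiv.swap_apply_right,
      Function.update_self, Fin.cons_zero, Matrix.mul_apply, Finset.sum_mul, mul_assoc]
    refine Finset.sum_congr rfl fun p _ => ?_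
    congr 2
    refine Finset.prod_congr rfl fun i hi => ?_
    have hij : i ≠ j := Finset.ne_of_mem_erase hi
    rw [Function.update_of_ne hij, Equiv.swap_apply_of_ne_of_ne (Fin.succ_ne_zero _)
      (by simpa using hij), Fin.cons_succ]

variable [DecidableEq ι]

/-- A cycle avoiding the last index contributes the trace of a positive power of Y, which vanishes,
so only full cycles survive. In the induction 0 cannot be fixed, and its m + 1 possible mergers all
contribute equally. -/
theorem permTrace_pow_mul {Y : Matrix ι ι R} (hY : ∀ k, 0 < k → (Y ^ k).trace = 0)
    (Z : Matrix ι ι R) (m : ℕ) (a : Fin (m + 1) → ℕ) (ha : ∀ i, i ≠ Fin.last m → 0 < a i) :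
    permTrace (fun i => Y ^ a i * if i = Fin.last m then Z else 1) =
      m.factorial * (Y ^ (∑ i, a i) * Z).trace := by
  induction m with
  | zero => simp [permTrace_one]
  | succ m ih =>
    have h0 : (0 : Fin (m + 1 + 1)) ≠ Fin.last (m + 1) := (Fin.last_pos).ne
    have key (j : Fin (m + 1)) : permTrace (Function.update
        (fun i : Fin (m + 1) => Y ^ a i.succ * if i.succ = Fin.last (m + 1) then Z else 1) j
        (Y ^ a 0 * (Y ^ a j.succ * if j.succ = Fin.last (m + 1) then Z else 1))) =
        m.factorial * (Y ^ (∑ i, a i) * Z).trace := by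
      have := ih (Function.update (fun i => a i.succ) j (a 0 + a j.succ)) (by
        intro i hi
        rcases eq_or_ne i j with rfl | hij
        · simp [ha 0 h0]
        · rw [Function.update_of_ne hij]
          exact ha _ (by simpa [← Fin.succ_last] using hi))
      have hs : ∑ i, Function.update (fun i => a i.succ) j (a 0 + a j.succ) i = ∑ i, a i := by
        rw [Finset.sum_update_of_mem (Finset.mem_univ _), add_assoc,
          Finset.sdiff_singleton_eq_erase,
          Finset.add_sum_erase _ (fun i : Fin (m + 1) => a i.succ) (Finset.mem_univ j),
          Fin.sum_univ_succ a]
      rw [← hs, ← this]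
      congr 1
      funext i
      rcases eq_or_ne i j with rfl | hij
      · simp [pow_add, mul_assoc, ← Fin.succ_last]
      · simp [hij, ← Fin.succ_last]
    rw [permTrace_succ]
    simp only [if_neg h0, mul_one, hY _ (ha 0 h0), zero_mul, zero_add, key]
    simp [Nat.factorial_succ, mul_assoc]

/-- Taking Z to be a matrix unit isolates the entry in the last slot. That entry may then lie in a
module over the commutative ring; below it is an odd element of the exterior algebra. -/
theorem sum_perm_prod_smul {M : Type*} [AddCommGroup M] [Module R M] {Y : Matrix ι ι R}
    (hY : ∀ k, 0 < k → (Y ^ k).trace = 0) (x : ι → ι → M) (m : ℕ) :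
    ∑ τ : Equiv.Perm (Fin (m + 1)), ∑ g : Fin (m + 1) → ι,
        (∏ i : Fin m, Y (g (τ i.castSucc)) (g i.castSucc)) •
          x (g (τ (Fin.last m))) (g (Fin.last m)) =
      (m.factorial : R) • ∑ p, ∑ q, (Y ^ m) q p • x p q := by
  have key (p q : ι) : ∑ τ : Equiv.Perm (Fin (m + 1)), ∑ g : Fin (m + 1) → ι,
      (∏ i : Fin m, Y (g (τ i.castSucc)) (g i.castSucc)) *
        Matrix.single p q 1 (g (τ (Fin.last m))) (g (Fin.last m)) =
      m.factorial * (Y ^ m) q p := by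
    have := permTrace_pow_mul hY (Matrix.single p q 1) m
      (fun i => if i = Fin.last m then 0 else 1) (by intro i hi; simp [hi])
    simpa [permTrace, Fin.prod_univ_castSucc, Fin.sum_univ_castSucc, (Fin.castSucc_lt_last _).ne,
      Matrix.trace_mul_single] using this
  simp only [Finset.smul_sum, smul_smul, ← key, Finset.sum_smul]
  simp only [Matrix.single_apply, mul_ite, mul_one, mul_zero, ite_smul, zero_smul, ite_and]
  simp only [Finset.sum_comm (s := (Finset.univ : Finset ι)),
    Finset.sum_ite_eq', Finset.mem_univ, if_true]

end PermTrace

/-! ### Matrices with odd entries and their even powers. -/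

section Exterior

variable {M : Type*} [AddCommGroup M] [Module ℂ M]

local notation "Λ" => ExteriorAlgebra ℂ M

theorem ι_mul_ι_anticomm (u v : M) :
    ExteriorAlgebra.ι ℂ u * ExteriorAlgebra.ι ℂ v =
      -(ExteriorAlgebra.ι ℂ v * ExteriorAlgebra.ι ℂ u) :=
  eq_neg_of_add_eq_zero_left (ExteriorAlgebra.ι_add_mul_swap u v)

theorem ι_mul_ι_mem_center (u v : M) :
    ExteriorAlgebra.ι ℂ u * ExteriorAlgebra.ι ℂ v ∈ Subalgebra.center ℂ Λ := by
  rw [Subalgebra.mem_center_iff]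
  intro x
  induction x using ExteriorAlgebra.induction with
  | algebraMap r => exact Algebra.commutes _ _
  | ι w =>
    rw [← mul_assoc, ι_mul_ι_anticomm w u, neg_mul, mul_assoc, ι_mul_ι_anticomm w v, mul_neg,
      neg_neg, mul_assoc]
  | mul a b ha hb => rw [mul_assoc, hb, ← mul_assoc, ha, mul_assoc]
  | add a b ha hb => rw [add_mul, mul_add, ha, hb]

/-- The product of two vectors, as an element of the center of the exterior algebra. -/
def ιMulι (u v : M) : Subalgebra.center ℂ Λ :=
  ⟨ExteriorAlgebra.ι ℂ u * ExteriorAlgebra.ι ℂ v, ι_mul_ι_mem_center u v⟩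

theorem center_mul_comm (r : Subalgebra.center ℂ Λ) (x : Λ) : (r : Λ) * x = x * r :=
  (Subalgebra.mem_center_iff.1 r.2 x).symm

variable {ι : Type*} [Fintype ι] [DecidableEq ι]

/-- The matrix of degree one elements of the exterior algebra with entries `x p q`. -/
def oddMatrix (x : ι → ι → M) : Matrix ι ι Λ :=
  Matrix.of fun p q => ExteriorAlgebra.ι ℂ (x p q)

/-- The square of `oddMatrix x`, which has central entries. -/
def evenMatrix (x : ι → ι → M) : Matrix ι ι (Subalgebra.center ℂ Λ) :=
  Matrix.of fun p q => ∑ h, ιMulι (x p h) (x h q)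

theorem map_evenMatrix_pow (x : ι → ι → M) (k : ℕ) :
    (evenMatrix x ^ k).map ((↑) : Subalgebra.center ℂ Λ → Λ) = oddMatrix x ^ (2 * k) := by
  have h : (Subalgebra.center ℂ Λ).val.mapMatrix (evenMatrix x) = oddMatrix x ^ 2 := by
    ext p q
    simp [evenMatrix, oddMatrix, ιMulι, pow_two, Matrix.mul_apply]
  rw [pow_mul, ← h, ← map_pow]
  rfl

/-- Cyclicity of the trace acquires a sign for odd matrices: moving one X around an even power gives
tr X^{2k} = -tr X^{2k}. -/
theorem trace_evenMatrix_pow (x : ι → ι → M) (k : ℕ) (hk : 0 < k) :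
    (evenMatrix x ^ k).trace = 0 := by
  obtain ⟨k, rfl⟩ := Nat.exists_eq_add_of_lt hk
  rw [zero_add]
  have hc : ((evenMatrix x ^ (k + 1)).trace : Λ) = (oddMatrix x ^ (2 * (k + 1))).trace := by
    rw [← map_evenMatrix_pow]
    simp [Matrix.trace]
  have h : (oddMatrix x * (oddMatrix x * oddMatrix x ^ (2 * k))).trace =
      -((oddMatrix x * oddMatrix x ^ (2 * k)) * oddMatrix x).trace := by
    rw [← map_evenMatrix_pow]
    simp only [Matrix.trace, Matrix.diag, Matrix.mul_apply, Finset.mul_sum, Finset.sum_mul,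
      Matrix.map_apply, oddMatrix, Matrix.of_apply, ← Finset.sum_neg_distrib]
    rw [Finset.sum_comm]
    refine Finset.sum_congr rfl fun q _ => Finset.sum_congr rfl fun p _ =>
      Finset.sum_congr rfl fun h _ => ?_
    rw [← mul_assoc, ι_mul_ι_anticomm, neg_mul, mul_assoc, mul_assoc, center_mul_comm]
  rw [mul_assoc, ← pow_succ, ← pow_succ', ← pow_succ', eq_neg_iff_add_eq_zero, ← two_smul ℂ,
    smul_eq_zero_iff_right two_ne_zero] at h
  exact Subtype.ext (hc.trans h)

/-- Each a_i is brought directly behind b_i; the resulting pairs are central, so they can be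
collected in any order. -/
theorem prod_ofFn_append_eq (m : ℕ) (a : Fin m → M) (b : Fin (m + 1) → M) :
    (List.ofFn fun i => ExteriorAlgebra.ι ℂ (a i)).prod *
        (List.ofFn fun i => ExteriorAlgebra.ι ℂ (b i)).prod =
      (-1 : ℂ) ^ (m + 1).choose 2 • ((∏ i, ιMulι (b i.castSucc) (a i) : Subalgebra.center ℂ Λ) •
        ExteriorAlgebra.ι ℂ (b (Fin.last m))) := by
  have comm (l : List M) (u : M) : ExteriorAlgebra.ι ℂ u * (l.map (ExteriorAlgebra.ι ℂ)).prod =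
      (-1 : ℂ) ^ l.length • ((l.map (ExteriorAlgebra.ι ℂ)).prod * ExteriorAlgebra.ι ℂ u) := by
    induction l with
    | nil => simp
    | cons v l ih =>
      rw [List.map_cons, List.prod_cons, ← mul_assoc, ι_mul_ι_anticomm, neg_mul, mul_assoc, ih,
        List.length_cons, pow_succ, mul_neg_one, neg_smul, mul_smul_comm, mul_assoc]
  induction m with
  | zero => simp
  | succ m ih =>
    -- The last a crosses m + 1 of the b's, and (m + 1 choose 2) + (m + 1) = (m + 2 choose 2).
    have h := comm (List.ofFn fun i : Fin (m + 1) => b i.castSucc) (a (Fin.last m))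
    rw [List.map_ofFn, List.length_ofFn] at h
    rw [List.ofFn_succ', List.ofFn_succ' (n := m + 1), List.concat_eq_append,
      List.concat_eq_append, List.prod_append, List.prod_append, List.prod_singleton,
      List.prod_singleton, mul_assoc, ← mul_assoc (ExteriorAlgebra.ι ℂ (a _))]
    erw [h]
    rw [smul_mul_assoc, mul_smul_comm, mul_assoc, ← mul_assoc (List.prod _)]
    erw [ih (fun i => a i.castSucc) (fun i => b i.castSucc)]
    rw [Fin.prod_univ_castSucc, smul_mul_assoc, smul_smul, ← pow_add,
      Nat.choose_succ_succ' (m + 1) 1, Nat.choose_one_right]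
    congr 1
    rw [Subalgebra.smul_def, Subalgebra.smul_def, smul_eq_mul, smul_eq_mul, Subalgebra.coe_mul]
    simp only [ιMulι, mul_assoc]

end Exterior

/-! ### Signed sums as top coefficients in the exterior algebra. -/

section Berezin

/-- The linear functional on the exterior algebra of `ℂ^N` that takes the coefficient of
`e₁ ∧ ⋯ ∧ e_N`. -/
def berezin (N : ℕ) : ExteriorAlgebra ℂ (Fin N → ℂ) →ₗ[ℂ] ℂ :=
  ExteriorAlgebra.liftAlternating (Pi.single N Matrix.detRowAlternating)

theorem berezin_prod_ofFn {N : ℕ} (u : Fin N → Fin N → ℂ) :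
    berezin N (List.ofFn fun i => ExteriorAlgebra.ι ℂ (u i)).prod = Matrix.det (Matrix.of u) := by
  rw [← ExteriorAlgebra.ιMulti_apply, berezin, ExteriorAlgebra.liftAlternating_apply_ιMulti,
    Pi.single_eq_same]
  rfl

variable {ι : Type*} [Fintype ι] [DecidableEq ι]

theorem sum_det_single_smul {N : ℕ} {E : Type*} [AddCommGroup E] [Module ℂ E]
    (F : (Fin N → Fin N) → E) :
    ∑ f : Fin N → Fin N, Matrix.det (Matrix.of fun i => (Pi.single (f i) 1 : Fin N → ℂ)) • F f =
      ∑ π : Equiv.Perm (Fin N), Equiv.Perm.sign π • F π := by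
  have h0 (f : Fin N → Fin N) (hf : ¬ f.Bijective) :
      Matrix.det (Matrix.of fun i => (Pi.single (f i) 1 : Fin N → ℂ)) = 0 := by
    rw [← Finite.injective_iff_bijective] at hf
    exact Matrix.detRowAlternating.map_eq_zero_of_not_injective _ fun h =>
      hf fun i j hij => h (congrArg (fun k => (Pi.single k 1 : Fin N → ℂ)) hij)
  have h1 (π : Equiv.Perm (Fin N)) :
      Matrix.det (Matrix.of fun i => (Pi.single (π i) 1 : Fin N → ℂ)) =
        ((Equiv.Perm.sign π : ℤ) : ℂ) := by
    rw [← Matrix.det_permutation]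
    congr 1
    ext i j
    simp [Equiv.Perm.permMatrix, PEquiv.toMatrix_apply, Pi.single_apply, eq_comm]
  symm
  refine Finset.sum_of_injOn (fun π : Equiv.Perm (Fin N) => (π : Fin N → Fin N))
    (fun _ _ _ _ h => DFunLike.coe_injective h) (fun _ _ => Finset.mem_univ _) ?_ ?_
  · intro f _ hf
    rw [h0 f, zero_smul]
    exact fun hb => hf ⟨Equiv.ofBijective f hb, Finset.mem_univ _, rfl⟩
  · intro π _
    rw [h1, Units.smul_def, Int.cast_smul_eq_zsmul]

/-- Expanding X = ∑ e_k A_k in X^N gives words in the e_k with the matching matrix products. The top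
coefficient kills words with a repeated letter and returns the sign of the others. -/
theorem berezin_trace_pow {N : ℕ} (A : Fin N → Matrix ι ι ℂ) :
    berezin N (oddMatrix (fun p q k => A k p q) ^ N).trace =
      ∑ π : Equiv.Perm (Fin N), Equiv.Perm.sign π • (List.ofFn fun i => A (π i)).prod.trace := by
  set alg := algebraMap ℂ (ExteriorAlgebra ℂ (Fin N → ℂ))
  let e (k : Fin N) : Fin N → ℂ := Pi.single k 1
  have hX : oddMatrix (fun p q k => A k p q) =
      ∑ k, ExteriorAlgebra.ι ℂ (e k) • (A k).map alg := by
    ext p q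
    have : (fun k => A k p q) = ∑ k, A k p q • e k := by
      ext j; simp [e, Finset.sum_apply, Pi.single_apply]
    rw [oddMatrix, Matrix.of_apply, this, map_sum, Matrix.sum_apply]
    refine Finset.sum_congr rfl fun k _ => ?_
    rw [map_smul, Matrix.smul_apply, Matrix.map_apply, smul_eq_mul, ← Algebra.commutes,
      Algebra.smul_def]
  have hprod (l : List (Fin N)) :
      (l.map fun k => ExteriorAlgebra.ι ℂ (e k) • (A k).map alg).prod =
        (l.map fun k => ExteriorAlgebra.ι ℂ (e k)).prod • ((l.map A).prod).map alg := by
    induction l with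
    | nil => ext p q; simp [Matrix.one_apply]
    | cons k l ih =>
      ext p q
      simp only [List.map_cons, List.prod_cons, ih, Matrix.mul_apply, Matrix.smul_apply,
        Matrix.map_apply, smul_eq_mul, map_sum, map_mul, Finset.mul_sum, mul_assoc]
      refine Finset.sum_congr rfl fun j _ => ?_
      congr 1
      exact (Algebra.left_comm _ _ _).symm
  have hpow : oddMatrix (fun p q k => A k p q) ^ N = ∑ f : Fin N → Fin N,
      (List.ofFn fun i => ExteriorAlgebra.ι ℂ (e (f i))).prod •
        ((List.ofFn fun i => A (f i)).prod).map alg := by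
    have h := (MultilinearMap.mkPiAlgebraFin ℂ N
      (Matrix ι ι (ExteriorAlgebra ℂ (Fin N → ℂ)))).map_sum
      (fun _ k => ExteriorAlgebra.ι ℂ (e k) • (A k).map alg)
    rw [← hX] at h
    simp only [MultilinearMap.mkPiAlgebraFin_apply, List.ofFn_const, List.prod_replicate] at h
    rw [h]
    refine Finset.sum_congr rfl fun f _ => ?_
    have := hprod (List.ofFn f)
    simpa only [List.map_ofFn, Function.comp_def] using this
  rw [hpow, Matrix.trace_sum, map_sum, ← sum_det_single_smul fun f =>
    (List.ofFn fun i => A (f i)).prod.trace]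
  refine Finset.sum_congr rfl fun f _ => ?_
  have : ∀ (r : ExteriorAlgebra ℂ (Fin N → ℂ)) (B : Matrix ι ι ℂ),
      (r • B.map alg).trace = B.trace • r := by
    intro r B
    simp only [Matrix.trace, Matrix.diag, Matrix.smul_apply, Matrix.map_apply, smul_eq_mul,
      Finset.sum_smul]
    refine Finset.sum_congr rfl fun p _ => ?_
    rw [← Algebra.commutes, Algebra.smul_def]
  rw [this, map_smul, berezin_prod_ofFn, smul_eq_mul, smul_eq_mul, mul_comm]

/-- Both sides are the determinant of the matrix with rows w, the left one by its Leibniz expansion.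
-/
theorem sum_sign_prod_eq_berezin {m n : ℕ} (w : Fin m ⊕ Fin n → Fin (m + n) → ℂ) :
    ∑ π : Equiv.Perm (Fin m ⊕ Fin n), Equiv.Perm.sign π •
        ((∏ i, w (.inl i) (finSumFinEquiv (π (.inl i)))) *
          ∏ i, w (.inr i) (finSumFinEquiv (π (.inr i)))) =
      berezin (m + n) ((List.ofFn fun i => ExteriorAlgebra.ι ℂ (w (.inl i))).prod *
        (List.ofFn fun i => ExteriorAlgebra.ι ℂ (w (.inr i))).prod) := by
  have h : (List.ofFn fun i => ExteriorAlgebra.ι ℂ (w (.inl i))).prod *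
        (List.ofFn fun i => ExteriorAlgebra.ι ℂ (w (.inr i))).prod =
      (List.ofFn fun i => ExteriorAlgebra.ι ℂ (w (finSumFinEquiv.symm i))).prod := by
    rw [← List.prod_append, ← List.ofFn_fin_append]
    congr 2
    ext i
    cases i using Fin.addCases <;> simp
  rw [h, berezin_prod_ofFn, ← Matrix.det_submatrix_equiv_self finSumFinEquiv,
    ← Matrix.det_transpose, Matrix.det_apply]
  simp

/-- For fixed τ and g the signed sum over π is a top coefficient in which the paired matrices have
become X². The vanishing of tr X^{2k} then reduces the sum over τ and g to m! tr X^{2m+1}. -/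
theorem sum_sign_sum_perm_prod {m : ℕ} (A : Fin (m + (m + 1)) → Matrix ι ι ℂ) :
    ∑ π : Equiv.Perm (Fin m ⊕ Fin (m + 1)), Equiv.Perm.sign π •
      ∑ τ : Equiv.Perm (Fin (m + 1)), ∑ g : Fin (m + 1) → ι,
        (∏ i : Fin m, (A (finSumFinEquiv (π (.inr i.castSucc))) *
          A (finSumFinEquiv (π (.inl i)))) (g (τ i.castSucc)) (g i.castSucc)) *
        A (finSumFinEquiv (π (.inr (Fin.last m)))) (g (τ (Fin.last m))) (g (Fin.last m)) =
      (-1 : ℂ) ^ (m + 1).choose 2 * m.factorial *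
        ∑ π : Equiv.Perm (Fin (m + (m + 1))),
          Equiv.Perm.sign π • (List.ofFn fun i => A (π i)).prod.trace := by
  let x (p q : ι) (k : Fin (m + (m + 1))) : ℂ := A k p q
  have hN : oddMatrix x ^ (m + (m + 1)) = oddMatrix x ^ (2 * m) * oddMatrix x := by
    rw [← pow_succ]; congr 1; ring
  have hT : (oddMatrix x ^ (m + (m + 1))).trace =
      ∑ p, ∑ q, (evenMatrix x ^ m) q p • ExteriorAlgebra.ι ℂ (x p q) := by
    rw [hN, ← map_evenMatrix_pow, Matrix.trace, Finset.sum_comm]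
    simp only [Matrix.diag, Matrix.mul_apply]
    rfl
  have key (τ : Equiv.Perm (Fin (m + 1))) (g : Fin (m + 1) → ι) :
      ∑ π : Equiv.Perm (Fin m ⊕ Fin (m + 1)), Equiv.Perm.sign π •
        ((∏ i : Fin m, (A (finSumFinEquiv (π (.inr i.castSucc))) *
          A (finSumFinEquiv (π (.inl i)))) (g (τ i.castSucc)) (g i.castSucc)) *
        A (finSumFinEquiv (π (.inr (Fin.last m)))) (g (τ (Fin.last m))) (g (Fin.last m))) =
      (-1 : ℂ) ^ (m + 1).choose 2 * berezin (m + (m + 1))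
        ((∏ i : Fin m, evenMatrix x (g (τ i.castSucc)) (g i.castSucc)) •
          ExteriorAlgebra.ι ℂ (x (g (τ (Fin.last m))) (g (Fin.last m)))) := by
    simp only [evenMatrix, Matrix.of_apply, Fintype.prod_sum, Finset.sum_smul, map_sum,
      Finset.mul_sum]
    -- Here h records the intermediate indices of the m products. The vectors of the right factors
    -- come first and those of the left factors after them, as in the wedge of Ψ with Φ*.
    have hh (h : Fin m → ι) := sum_sign_prod_eq_berezin (m := m) (n := m + 1)
      (Sum.elim (fun i => x (h i) (g i.castSucc))
        (Fin.snoc (α := fun _ => Fin (m + (m + 1)) → ℂ) (fun i => x (g (τ i.castSucc)) (h i))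
          (x (g (τ (Fin.last m))) (g (Fin.last m)))))
    simp only [Sum.elim_inl, Sum.elim_inr, prod_ofFn_append_eq, Fin.snoc_castSucc, Fin.snoc_last,
      map_smul, smul_eq_mul] at hh
    simp only [← hh]
    rw [Finset.sum_comm]
    refine Finset.sum_congr rfl fun π _ => ?_
    rw [← Finset.smul_sum]
    simp only [Matrix.mul_apply, Fintype.prod_sum, Finset.sum_mul]
    congr 1
    refine Finset.sum_congr rfl fun h _ => ?_
    rw [Fin.prod_univ_castSucc, ← mul_assoc, ← Finset.prod_mul_distrib]
    simp only [Fin.snoc_castSucc, Fin.snoc_last, x, mul_comm]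
  simp only [Finset.smul_sum]
  rw [Finset.sum_comm]
  simp only [Finset.sum_comm (s := (Finset.univ : Finset (Equiv.Perm (Fin m ⊕ Fin (m + 1))))),
    key, ← Finset.mul_sum]
  rw [← berezin_trace_pow, mul_assoc]
  congr 1
  have := congrArg (berezin (m + (m + 1))) (sum_perm_prod_smul (trace_evenMatrix_pow x)
    (fun p q => ExteriorAlgebra.ι ℂ (x p q)) m)
  simp only [map_sum] at this
  rw [this, ← hT, Nat.cast_smul_eq_nsmul, map_nsmul, nsmul_eq_mul]

end Berezin

/-! ### The pairing of covariants in coordinates. -/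

section Pairing

variable {V : Type*} [AddCommGroup V] [Module ℂ V] {ι : Type*} [Fintype ι]

/-- Expanding v_1 ⋯ v_n in the basis after any permutation of its factors gives the same element;
averaging over the permutations turns the coefficients into the pairing. -/
theorem eq_sum_symPairing_smul (b : Module.Basis ι ℂ V) {n : ℕ} (s : Sym[ℂ]^n V) :
    s = ∑ f : Fin n → ι, symPairing V n s (SymmetricPower.tprod ℂ fun i => b.coord (f i)) •
      SymmetricPower.tprod ℂ (fun i => b (f i)) := by
  have hn : (n.factorial : ℂ) ≠ 0 := by exact_mod_cast n.factorial_ne_zero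
  have hs : s ∈ Submodule.span ℂ (Set.range (SymmetricPower.tprod ℂ (ι := Fin n) (M := V))) := by
    rw [SymmetricPower.span_tprod_eq_top]; trivial
  induction hs using Submodule.span_induction with
  | mem x hx =>
    obtain ⟨v, rfl⟩ := hx
    have h (σ : Equiv.Perm (Fin n)) : SymmetricPower.tprod ℂ v =
        ∑ f : Fin n → ι,
          (∏ i, b.coord (f (σ i)) (v i)) • SymmetricPower.tprod ℂ (fun i => b (f i)) := by
      conv_lhs => rw [← SymmetricPower.tprod_equiv σ⁻¹ v]
      have : (fun i => v (σ⁻¹ i)) = fun i => ∑ j, b.coord j (v (σ⁻¹ i)) • b j := by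
        funext i; exact (b.sum_repr _).symm
      rw [this, MultilinearMap.map_sum]
      refine Finset.sum_congr rfl fun f _ => ?_
      rw [MultilinearMap.map_smul_univ]
      congr 1
      exact (Fintype.prod_equiv σ _ _ (fun i => by simp)).symm
    simp only [symPairing_tprod, mul_smul, Finset.sum_smul]
    rw [← Finset.smul_sum, Finset.sum_comm]
    simp only [← h, Finset.sum_const, Finset.card_univ, Fintype.card_perm, Fintype.card_fin]
    rw [← Nat.cast_smul_eq_nsmul ℂ, inv_smul_smul₀ hn]
  | zero => simp
  | add x y _ _ hx hy =>
    simp only [map_add, LinearMap.add_apply, add_smul, Finset.sum_add_distrib]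
    rw [← hx, ← hy]
  | smul c x _ hx =>
    simp only [map_smul, LinearMap.smul_apply, smul_assoc]
    rw [← Finset.smul_sum, ← hx]

/-- Summing over words instead of monomials removes all multinomial factors: a monomial of exponent
a pairs with its counterpart to a!/n!, and n!/a! words represent it. -/
theorem canonicalMap_one [FiniteDimensional ℂ V] (b : Module.Basis ι ℂ V) (n : ℕ) :
    canonicalMap V n 1 = ∑ f : Fin n → ι, SymmetricPower.tprod ℂ (fun i => b (f i)) ⊗ₜ[ℂ]
      SymmetricPower.tprod ℂ (fun i => b.coord (f i)) := by
  let w (f : Fin n → ι) : Sym[ℂ]^n V := SymmetricPower.tprod ℂ (fun i => b (f i))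
  let c (f : Fin n → ι) : Sym[ℂ]^n (Module.Dual ℂ V) :=
    SymmetricPower.tprod ℂ (fun i => b.coord (f i))
  have h (φ : Module.Dual ℂ (Sym[ℂ]^n V)) :
      (symPairing V n).flip.toPerfPair.symm φ = ∑ f, φ (w f) • c f := by
    rw [LinearEquiv.symm_apply_eq]
    ext s
    conv_lhs => rw [eq_sum_symPairing_smul b s]
    simp [w, c, mul_comm, LinearMap.sum_apply]
  rw [canonicalMap, LinearMap.comp_apply, coevaluation_apply_one]
  simp only [map_sum, LinearMap.lTensor_tmul, LinearEquiv.coe_coe, h, TensorProduct.tmul_sum]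
  rw [Finset.sum_comm]
  refine Finset.sum_congr rfl fun f _ => ?_
  simp only [TensorProduct.tmul_smul, TensorProduct.smul_tmul']
  rw [← TensorProduct.sum_tmul]
  congr 1
  exact (Module.Basis.ofVectorSpace ℂ (Sym[ℂ]^n V)).sum_repr _

theorem alternatingMap_sum_apply {M N κ α : Type*} [AddCommMonoid M] [Module ℂ M]
    [AddCommMonoid N] [Module ℂ N] (s : Finset α) (F : α → M [⋀^κ]→ₗ[ℂ] N) (v : κ → M) :
    (∑ a ∈ s, F a) v = ∑ a ∈ s, F a v :=
  map_sum (⟨⟨fun G => G v, rfl⟩, fun _ _ => rfl⟩ : M [⋀^κ]→ₗ[ℂ] N →+ N) F s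

/-- Clearing i! j! replaces the sum over shuffles by one over all permutations. -/
theorem factorial_mul_covariantPairing [FiniteDimensional ℂ V] (b : Module.Basis ι ℂ V) {n i j : ℕ}
    (α : Sym[ℂ]^n V →ₗ[ℂ] (sl V [⋀^Fin i]→ₗ[ℂ] ⋀[ℂ]^n V))
    (β : Sym[ℂ]^n (Module.Dual ℂ V) →ₗ[ℂ] (sl V [⋀^Fin j]→ₗ[ℂ] ⋀[ℂ]^n (Module.Dual ℂ V)))
    (X : Fin (i + j) → sl V) :
    (i.factorial * j.factorial : ℂ) * covariantPairing α β X =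
      ∑ π : Equiv.Perm (Fin i ⊕ Fin j), Equiv.Perm.sign π • ∑ f : Fin n → ι,
        trivialization V n
          (α (SymmetricPower.tprod ℂ fun k => b (f k)) (fun k => X (finSumFinEquiv (π (.inl k))))
            ⊗ₜ[ℂ] β (SymmetricPower.tprod ℂ fun k => b.coord (f k))
              (fun k => X (finSumFinEquiv (π (.inr k))))) := by
  have h (f : Fin n → ι) := congrArg (fun F => trivialization V n (F (X ∘ finSumFinEquiv)))
    (MultilinearMap.domCoprod_alternization_eq (α (SymmetricPower.tprod ℂ fun k => b (f k)))
      (β (SymmetricPower.tprod ℂ fun k => b.coord (f k))))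
  simp only [AlternatingMap.smul_apply, map_nsmul, Fintype.card_fin, nsmul_eq_mul,
    Nat.cast_mul] at h
  simp only [covariantPairing, canonicalMap_one b, map_sum, TensorProduct.map_tmul,
    AlternatingMap.domDomCongr_apply, LinearMap.compAlternatingMap_apply,
    AlternatingMap.domCoprod'_apply, alternatingMap_sum_apply, Finset.mul_sum]
  simp only [Finset.smul_sum]
  rw [Finset.sum_comm]
  refine Finset.sum_congr rfl fun f _ => ?_
  rw [← h, MultilinearMap.alternatization_apply, map_sum]
  refine Finset.sum_congr rfl fun π _ => ?_
  rw [Units.smul_def, Units.smul_def, map_zsmul]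
  rfl

variable [DecidableEq ι]

/-- The permutation ρ comes from the determinant. Both polarizations carry 1/n!, but one of their
two sums is redundant after relabelling f, which cancels one factor. -/
theorem sum_trivialization_wedgeEnd (b : Module.Basis ι ℂ V) {n : ℕ}
    (A B : Fin n → Module.End ℂ V) :
    ∑ f : Fin n → ι, trivialization V n
        (wedgeEnd V n (SymmetricPower.tprod ℂ fun i => b (f i)) A ⊗ₜ[ℂ]
          wedgeEnd (Module.Dual ℂ V) n (SymmetricPower.tprod ℂ fun i => b.coord (f i))
            (fun i => Module.Dual.transpose (B i))) =
      (n.factorial : ℂ)⁻¹ * ∑ ρ : Equiv.Perm (Fin n), Equiv.Perm.sign ρ •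
        ∑ τ : Equiv.Perm (Fin n), ∑ g : Fin n → ι,
          ∏ i, LinearMap.toMatrixAlgEquiv b (B (ρ i) * A i) (g (τ i)) (g i) := by
  have hn : (n.factorial : ℂ) ≠ 0 := by exact_mod_cast n.factorial_ne_zero
  have hdet (f : Fin n → ι) (σ τ : Equiv.Perm (Fin n)) : trivialization V n
      (exteriorPower.ιMulti ℂ n (fun i => A i (b (f (σ i)))) ⊗ₜ[ℂ]
        exteriorPower.ιMulti ℂ n (fun i => Module.Dual.transpose (B i) (b.coord (f (τ i))))) =
      ∑ ρ : Equiv.Perm (Fin n), Equiv.Perm.sign ρ •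
        ∏ i, LinearMap.toMatrixAlgEquiv b (B (ρ i) * A i) (f (τ (ρ i))) (f (σ i)) := by
    rw [trivialization_ιMulti, ← Matrix.det_transpose, Matrix.det_apply]
    simp [LinearMap.toMatrixAlgEquiv_apply, Module.Dual.transpose_apply]
  -- Substitute τ ↦ σ τ ρ⁻¹ and f = g ∘ σ⁻¹; the result no longer depends on σ.
  have hsum (σ ρ : Equiv.Perm (Fin n)) :
      ∑ τ : Equiv.Perm (Fin n), ∑ f : Fin n → ι,
        ∏ i, LinearMap.toMatrixAlgEquiv b (B (ρ i) * A i) (f (τ (ρ i))) (f (σ i)) =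
      ∑ τ : Equiv.Perm (Fin n), ∑ g : Fin n → ι,
        ∏ i, LinearMap.toMatrixAlgEquiv b (B (ρ i) * A i) (g (τ i)) (g i) := by
    rw [← ((Equiv.mulLeft σ).trans (Equiv.mulRight ρ⁻¹)).sum_comp]
    refine Finset.sum_congr rfl fun τ _ => ?_
    rw [← (Equiv.arrowCongr σ (Equiv.refl ι)).sum_comp]
    simp
  simp only [wedgeEnd, symLift_tprod, polarizedWedge_apply, TensorProduct.tmul_smul,
    ← TensorProduct.smul_tmul', TensorProduct.sum_tmul, TensorProduct.tmul_sum, map_smul,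
    map_sum, hdet, ← Finset.smul_sum]
  have hcomm : ∑ f : Fin n → ι, ∑ σ : Equiv.Perm (Fin n), ∑ τ : Equiv.Perm (Fin n),
      ∑ ρ : Equiv.Perm (Fin n), Equiv.Perm.sign ρ •
        ∏ i, LinearMap.toMatrixAlgEquiv b (B (ρ i) * A i) (f (τ (ρ i))) (f (σ i)) =
      ∑ σ : Equiv.Perm (Fin n), ∑ ρ : Equiv.Perm (Fin n), Equiv.Perm.sign ρ •
        ∑ τ : Equiv.Perm (Fin n), ∑ f : Fin n → ι,
          ∏ i, LinearMap.toMatrixAlgEquiv b (B (ρ i) * A i) (f (τ (ρ i))) (f (σ i)) := by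
    rw [Finset.sum_comm]
    refine Finset.sum_congr rfl fun σ _ => ?_
    simp only [Finset.smul_sum]
    rw [Finset.sum_comm]
    conv_rhs => rw [Finset.sum_comm]
    exact Finset.sum_congr rfl fun τ _ => Finset.sum_comm
  have hcomm' : ∑ f : Fin n → ι, ∑ τ : Equiv.Perm (Fin n), ∑ σ : Equiv.Perm (Fin n),
      ∑ ρ : Equiv.Perm (Fin n), Equiv.Perm.sign ρ •
        ∏ i, LinearMap.toMatrixAlgEquiv b (B (ρ i) * A i) (f (τ (ρ i))) (f (σ i)) = _ :=
    (Finset.sum_congr rfl fun f _ => Finset.sum_comm).trans hcomm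
  simp only [hcomm', hsum, Finset.sum_const, Finset.card_univ, Fintype.card_perm,
    Fintype.card_fin, ← Nat.cast_smul_eq_nsmul ℂ, smul_eq_mul, inv_mul_cancel_left₀ hn]

/-- Right translation of π by 1 ⊕ ρ absorbs ρ together with its sign. -/
theorem sum_sign_smul_sum_sign_smul {m n : ℕ} {E : Type*} [AddCommGroup E]
    (S : (Fin m ⊕ Fin n → Fin m ⊕ Fin n) → E) :
    ∑ π : Equiv.Perm (Fin m ⊕ Fin n), Equiv.Perm.sign π • ∑ ρ : Equiv.Perm (Fin n),
        Equiv.Perm.sign ρ • S (π ∘ Sum.map id ρ) =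
      n.factorial • ∑ π : Equiv.Perm (Fin m ⊕ Fin n), Equiv.Perm.sign π • S π := by
  have (ρ : Equiv.Perm (Fin n)) : ∑ π : Equiv.Perm (Fin m ⊕ Fin n),
      Equiv.Perm.sign π • Equiv.Perm.sign ρ • S (π ∘ Sum.map id ρ) =
        ∑ π : Equiv.Perm (Fin m ⊕ Fin n), Equiv.Perm.sign π • S π := by
    refine Fintype.sum_equiv (Equiv.mulRight (Equiv.Perm.sumCongr 1 ρ)) _ _ fun π => ?_
    rw [Equiv.coe_mulRight, Equiv.Perm.sign_mul, Equiv.Perm.sign_sumCongr, map_one, one_mul,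
      mul_smul]
    rfl
  simp only [Finset.smul_sum]
  rw [Finset.sum_comm]
  simp only [this, Finset.sum_const, Finset.card_univ, Fintype.card_perm, Fintype.card_fin,
    Finset.smul_sum]

theorem primitiveInvariant_domDomCongr_apply (b : Module.Basis ι ℂ V) {m N : ℕ}
    (h : 2 * m + 1 = N) (X : Fin N → sl V) :
    (primitiveInvariant V m).domDomCongr (finCongr h) X =
      ∑ π : Equiv.Perm (Fin N), Equiv.Perm.sign π •
        (List.ofFn fun i => LinearMap.toMatrixAlgEquiv b (X (π i) : Module.End ℂ V)).prod.trace := by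
  subst h
  have (f : Module.End ℂ V) : LinearMap.trace ℂ V f = (LinearMap.toMatrixAlgEquiv b f).trace :=
    LinearMap.trace_eq_matrix_trace ℂ b f
  rw [primitiveInvariant, AlternatingMap.domDomCongr_apply, AlternatingMap.compLinearMap_apply,
    LinearMap.compAlternatingMap_apply, standardPolynomial_apply, map_sum]
  refine Finset.sum_congr rfl fun π _ => ?_
  rw [Units.smul_def, Units.smul_def, map_zsmul, this, map_list_prod, List.map_ofFn]
  rfl

end Pairing

end SlCovariants

end

/-! ### Assembly of the constants. -/

theorem theorem3p1 {V : Type*} [AddCommGroup V] [Module ℂ V] [FiniteDimensional ℂ V]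
    (m : ℕ) (hV : Module.finrank ℂ V = m + 1) :
    SlCovariants.covariantPairing (SlCovariants.Psi V m) (SlCovariants.PhiStar V (m + 1)) =
      ((-1 : ℂ) ^ (m + 1).choose 2 / ((m + 1).factorial : ℂ)) •
        (SlCovariants.primitiveInvariant V m).domDomCongr
          (finCongr (by omega : 2 * m + 1 = m + (m + 1))) := by
  open SlCovariants in
  have hm : (m.factorial : ℂ) ≠ 0 := by exact_mod_cast m.factorial_ne_zero
  have hn : ((m + 1).factorial : ℂ) ≠ 0 := by exact_mod_cast (m + 1).factorial_ne_zero
  let b := Module.finBasis ℂ V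
  refine AlternatingMap.ext fun X => ?_
  rw [AlternatingMap.smul_apply, primitiveInvariant_domDomCongr_apply b, smul_eq_mul]
  obtain ⟨A, hA⟩ : ∃ A : Fin (m + (m + 1)) → Matrix _ _ ℂ,
      ∀ k, LinearMap.toMatrixAlgEquiv b (X k : Module.End ℂ V) = A k := ⟨_, fun _ => rfl⟩
  have h1 := factorial_mul_covariantPairing b (Psi V m) (PhiStar V (m + 1)) X
  -- The identity in the last slot of Ψ leaves the last matrix of Φ* unpaired, giving m products and
  -- one single factor.
  simp only [Psi_apply, PhiStar_apply, sum_trivialization_wedgeEnd, Fin.prod_univ_castSucc,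
    Fin.snoc_castSucc, Fin.snoc_last, map_mul, map_one, mul_one, hA, ← mul_smul_comm,
    ← Finset.mul_sum] at h1
  have h2 := sum_sign_smul_sum_sign_smul (m := m) (n := m + 1) fun s =>
    ∑ τ : Equiv.Perm (Fin (m + 1)), ∑ g : Fin (m + 1) → Fin (Module.finrank ℂ V),
      (∏ i : Fin m, (A (finSumFinEquiv (s (.inr i.castSucc))) *
        A (finSumFinEquiv (s (.inl i)))) (g (τ i.castSucc)) (g i.castSucc)) *
      A (finSumFinEquiv (s (.inr (Fin.last m)))) (g (τ (Fin.last m))) (g (Fin.last m))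
  rw [sum_sign_sum_perm_prod A, nsmul_eq_mul] at h2
  simp only [Function.comp_apply, Sum.map_inl, Sum.map_inr, id] at h2
  rw [h2, inv_mul_cancel_left₀ hn] at h1
  simp only [hA]
  generalize ∑ π : Equiv.Perm (Fin (m + (m + 1))),
    Equiv.Perm.sign π • (List.ofFn fun i => A (π i)).prod.trace = t at h1 ⊢
  -- By now `h1` says that m! (m+1)! times the pairing is (-1)^{m+1 choose 2} m! t, so m! cancels.
  rw [div_mul_eq_mul_div, eq_div_iff hn]
  apply mul_left_cancel₀ hm
  linear_combination h1
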